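/- **Setting.** A data set is a tuple $\mathcal D=((x_i,y_i))_{i=1}^n$ with $x_i\in\mathbb R^d$ and labels $y_i\in[-1,1]$ (for example $y_i\in\{-1,1\}$). Two data sets of the same size are neighbours if they differ in the value of at most one entry. A randomized mechanism $M$ is $\epsilon$-differentially private if $\Pr(M(\mathcal D)\in S)\le e^{\epsilon}\Pr(M(\mathcal D')\in S)$ for all neighbours $\mathcal D,\mathcal D'$ and all measurable sets $S$ of outputs. Let $\ell(\hat y,y)=\log(1+e^{-y\hat y})$ and $\sigma(a)=e^a/(1+e^a)$. A function $g:\mathbb R^m\to\mathbb R$ is $1$-strongly convex if $g(\alpha w+(1-\alpha)u)\le\alpha g(w)+(1-\alpha)g(u)-\tfrac12\alpha(1-\alpha)\|w-u\|^2$ for all $w,u$ and $\alpha\in(0,1)$; no differentiability is assumed. To scale a vector to norm at most $r$ means to replace it by a nonnegative multiple of it of norm at most $r$, by a rule (a map, measurable in the case of the high-level model) that depends on that vector only and not on the rest of the data. **PLR** with budget $\epsilon>0$, parameter $\lambda>0$ and regularizer $g$, on $n\ge 1$ samples in $\mathbb R^m$. Put $\epsilon'=\epsilon-\log\bigl(1+\frac1{2n\lambda}+\frac1{16n^2\lambda^2}\bigr)$.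 If $\epsilon'>0$ let $\Delta=0$; otherwise let $\Delta=\frac1{4n(e^{\epsilon/4}-1)}-\lambda$ and replace $\epsilon'$ by $\epsilon/2$. Scale all $x_i$ to norm at most $1$, draw $b\in\mathbb R^m$ with density proportional to $e^{-\epsilon'\|b\|/2}$, and return $$\arg\min_w\ \frac1n\sum_i\ell(w^\top x_i,y_i)+\frac{b^\top w}{n}+\frac{\Delta\|w\|^2}{2}+\lambda g(w).$$ **PST-F** (privacy-preserving stacking with feature partitioning) with budget $\epsilon>0$, importances $q_k\ge0$, $\sum_{k=1}^Kq_k=1$, low-level parameters $\lambda_k>0$ and regularizers $g_k$, and high-level parameter $\lambda^h>0$ and regularizer $g^h$. Fix a partition of the positions $\{1,\dots,n\}$ into two nonempty sets, which splits $\mathcal D$ into $\mathcal D^l$ and $\mathcal D^h$, and a partition of the $d$ features into $K$ blocks; write $x_{(k)}$ for the vector of the features of $x$ in block $k$, and $n_l=|\mathcal D^l|$. Put $$\epsilon'=\epsilon-\sum_{k=1}^K\log\Bigl(1+\frac{q_k^2}{2n_l\lambda_k}+\frac{q_k^4}{16n_l^2\lambda_k^2}\Bigr).$$ If $\epsilon'>0$,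 let $\Delta_k=0$ and $\epsilon_k=\epsilon'$ for all $k$. Otherwise let $\epsilon_k=\epsilon/2$ and $\Delta_k=\frac{q_k^2}{4n_l(e^{\epsilon q_k/4}-1)}-\lambda_k$, with $\Delta_k=0$ if $q_k=0$. For each $k$, let $\bar x_{i,k}$ be $x_{i,(k)}$ scaled to norm at most $q_k$, draw $b_k$ independently with density proportional to $e^{-\epsilon_k\|b_k\|/2}$, and let $$w_k^l=\arg\min_w\ \frac1{n_l}\sum_{i\in\mathcal D^l}\ell(w^\top\bar x_{i,k},y_i)+\frac{b_k^\top w}{n_l}+\frac{\Delta_k\|w\|^2}{2}+\lambda_kg_k(w).$$ Then run PLR with budget $\epsilon$, parameter $\lambda^h$, regularizer $g^h$ and independent noise on the meta-data $\bigl([\sigma(x_{(1)}^\top w_1^l),\dots,\sigma(x_{(K)}^\top w_K^l)],y\bigr)$, $(x,y)\in\mathcal D^h$, to obtain $w^h\in\mathbb R^K$. The output is $(w_1^l,\dots,w_K^l,w^h)$. **Theorem.** If all low-level regularizers $g_k$ and the high-level regularizer $g^h$ are $1$-strongly convex, then PST-F is well defined (every $\arg\min$ exists and is unique, and the output is a random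 vector), and it is $\epsilon$-differentially private. -/

import Mathlib

open MeasureTheory

noncomputable section

namespace PrivateStacking

/-! ### Differential privacy -/

/-- Two data sets of the same size that differ in the value of at most one entry. -/
def Neighbours {ι X : Type*} (D D' : ι → X) : Prop :=
  ∃ i, ∀ j, j ≠ i → D j = D' j

/-- `M D` is the law of the output of the randomized mechanism on the data set `D`. -/
def IsDifferentiallyPrivate {ι X O : Type*} [MeasurableSpace O] (ε : ℝ)
    (M : (ι → X) → Measure O) : Prop :=
  ∀ D D' : ι → X, Neighbours D D' →
    ∀ S : Set O, MeasurableSet S → M D S ≤ ENNReal.ofReal (Real.exp ε) * M D' S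

/-! ### Objective perturbation for logistic regression -/

/-- A labelled sample. The labels `-1` and `1` are the class labels of logistic regression. -/
structure Sample (d : ℕ) where
  /-- the feature vector -/
  x : EuclideanSpace ℝ (Fin d)
  /-- the label -/
  y : ℝ
  abs_y_le_one : |y| ≤ 1

/-- The logistic loss of the prediction `yhat` for the label `y`. -/
def logLoss (yhat y : ℝ) : ℝ := Real.log (1 + Real.exp (-y * yhat))

/-- The perturbed regularized empirical risk on the samples `(x i, y i)`, `i ∈ I`:
`(1/n) ∑ ℓ(wᵀ xᵢ, yᵢ) + bᵀ w / n + Δ ‖w‖² / 2 + lam * g w`, where `n` is the number of samples. -/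
def objective {ι E : Type*} [NormedAddCommGroup E] [InnerProductSpace ℝ E]
    (I : Finset ι) (x : ι → E) (y : ι → ℝ) (b : E) (Δ lam : ℝ) (g : E → ℝ) (w : E) : ℝ :=
  1 / (I.card : ℝ) * ∑ i ∈ I, logLoss (inner ℝ w (x i)) (y i)
    + inner ℝ b w / (I.card : ℝ) + Δ * ‖w‖ ^ 2 / 2 + lam * g w

/-- `w` is a global minimizer of `f`. -/
def IsMinimizer {E : Type*} (f : E → ℝ) (w : E) : Prop := ∀ u, f w ≤ f u

/-- A global minimizer of `f` (an arbitrary point if there is none). -/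
def argmin {E : Type*} [Nonempty E] (f : E → ℝ) : E := Classical.epsilon (IsMinimizer f)

/-- The law with density proportional to `exp (-ε ‖b‖ / 2)`. -/
def noise (E : Type*) [NormedAddCommGroup E] [MeasureSpace E] (ε : ℝ) : Measure E :=
  (∫⁻ b : E, ENNReal.ofReal (Real.exp (-(ε * ‖b‖ / 2))))⁻¹ •
    (volume : Measure E).withDensity (fun b => ENNReal.ofReal (Real.exp (-(ε * ‖b‖ / 2))))

/-- `s` replaces every vector by a nonnegative multiple of it of norm at most `r`. -/
def IsScaling {E : Type*} [NormedAddCommGroup E] [NormedSpace ℝ E] (r : ℝ) (s : E → E) : Prop :=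
  ∀ x, (∃ c : ℝ, 0 ≤ c ∧ s x = c • x) ∧ ‖s x‖ ≤ r

/-! ### PLR: privacy-preserving logistic regression -/

/-- The modified budget before the case distinction, for `n` samples. -/
def plrEpsPrime (n : ℕ) (ε lam : ℝ) : ℝ :=
  ε - Real.log (1 + 1 / (2 * n * lam) + 1 / (16 * (n : ℝ) ^ 2 * lam ^ 2))

/-- The budget that calibrates the noise. -/
def plrEps (n : ℕ) (ε lam : ℝ) : ℝ :=
  if 0 < plrEpsPrime n ε lam then plrEpsPrime n ε lam else ε / 2

/-- The coefficient of the additional quadratic term. -/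
def plrDelta (n : ℕ) (ε lam : ℝ) : ℝ :=
  if 0 < plrEpsPrime n ε lam then 0 else (4 * n * (Real.exp (ε / 4) - 1))⁻¹ - lam

/-- The objective that PLR minimizes on the samples `(x i, y i)`, `i ∈ I`, for the noise `b`. -/
def plrObjective {ι E : Type*} [NormedAddCommGroup E] [InnerProductSpace ℝ E]
    (ε lam : ℝ) (g : E → ℝ) (s : E → E) (I : Finset ι) (x : ι → E) (y : ι → ℝ) (b : E) :
    E → ℝ :=
  objective I (fun i => s (x i)) y b (plrDelta I.card ε lam) lam g

/-! ### PST-F: privacy-preserving stacking with feature partitioning -/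

/-- The parameter vectors of a low-level model: one coordinate for each feature of block `k`. -/
abbrev Block {d K : ℕ} (block : Fin d → Fin K) (k : Fin K) : Type :=
  EuclideanSpace ℝ {j : Fin d // block j = k}

/-- The features of `x` that belong to block `k`. -/
def restrict {d K : ℕ} (block : Fin d → Fin K) (k : Fin K) (x : EuclideanSpace ℝ (Fin d)) :
    Block block k :=
  WithLp.toLp 2 (fun j => x j.1)

/-- The inputs and hyperparameters of PST-F other than the data set, for `n` samples with `d`
features in `K` blocks. -/
structure Config (n d K : ℕ) where
  /-- the privacy budget -/
  ε : ℝ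
  /-- the positions of the samples that train the low-level models; the other samples train the
  high-level model -/
  low : Finset (Fin n)
  /-- the block to which a feature belongs -/
  block : Fin d → Fin K
  /-- the importance of the blocks -/
  q : Fin K → ℝ
  /-- the regularization parameters of the low-level models -/
  lam : Fin K → ℝ
  /-- the regularizers of the low-level models -/
  g : ∀ k, Block block k → ℝ
  /-- the scaling applied to the low-level samples -/
  scale : ∀ k, Block block k → Block block k
  /-- the regularization parameter of the high-level model -/
  lamHigh : ℝ
  /-- the regularizer of the high-level model -/
  gHigh : EuclideanSpace ℝ (Fin K) → ℝ
  /-- the scaling applied by PLR to the meta-data -/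
  scaleHigh : EuclideanSpace ℝ (Fin K) → EuclideanSpace ℝ (Fin K)

namespace Config

variable {n d K : ℕ} (C : Config n d K)

/-- The modified budget before the case distinction. -/
def epsPrime : ℝ :=
  C.ε - ∑ k, Real.log (1 + C.q k ^ 2 / (2 * C.low.card * C.lam k)
    + C.q k ^ 4 / (16 * (C.low.card : ℝ) ^ 2 * C.lam k ^ 2))

/-- The budget that calibrates the noise of the low-level models. -/
def lowEps : ℝ := if 0 < C.epsPrime then C.epsPrime else C.ε / 2

/-- The coefficient of the additional quadratic term of low-level model `k`. In the second case the
quotient reads `0 / 0` for a block of importance zero; such a block gets no additional term. -/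
def lowDelta (k : Fin K) : ℝ :=
  if 0 < C.epsPrime ∨ C.q k = 0 then 0
  else C.q k ^ 2 / (4 * C.low.card * (Real.exp (C.ε * C.q k / 4) - 1)) - C.lam k

/-- The objective of low-level model `k` for the noise `b`. -/
def lowObjective (D : Fin n → Sample d) (k : Fin K) (b : Block C.block k) :
    Block C.block k → ℝ :=
  objective C.low (fun i => C.scale k (restrict C.block k (D i).x)) (fun i => (D i).y) b
    (C.lowDelta k) (C.lam k) (C.g k)

/-- The features of the meta-data: the predictions of the low-level models `w`. -/
def metaFeatures (w : ∀ k, Block C.block k) (x : EuclideanSpace ℝ (Fin d)) :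
    EuclideanSpace ℝ (Fin K) :=
  WithLp.toLp 2 (fun k => Real.sigmoid (inner ℝ (restrict C.block k x) (w k)))

/-- The objective of the high-level model: PLR with the full budget on the meta-data that are made
from the remaining samples by the low-level models `w`. -/
def highObjective (D : Fin n → Sample d) (w : ∀ k, Block C.block k)
    (b : EuclideanSpace ℝ (Fin K)) : EuclideanSpace ℝ (Fin K) → ℝ :=
  plrObjective C.ε C.lamHigh C.gHigh C.scaleHigh C.lowᶜ
    (fun i => C.metaFeatures w (D i).x) (fun i => (D i).y) b

/-- The low-level models for the noise vectors `b k`. -/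
def lowModels (D : Fin n → Sample d) (b : ∀ k, Block C.block k) : ∀ k, Block C.block k :=
  fun k => argmin (C.lowObjective D k (b k))

/-- The output of PST-F, low-level models and high-level model, as a function of the data set and
of all noise vectors. -/
def output (D : Fin n → Sample d) (b : (∀ k, Block C.block k) × EuclideanSpace ℝ (Fin K)) :
    (∀ k, Block C.block k) × EuclideanSpace ℝ (Fin K) :=
  (C.lowModels D b.1, argmin (C.highObjective D (C.lowModels D b.1) b.2))

/-- The joint law of the independent noise vectors of PST-F. -/
def noiseLaw : Measure ((∀ k, Block C.block k) × EuclideanSpace ℝ (Fin K)) :=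
  (Measure.pi fun k => noise (Block C.block k) C.lowEps).prod
    (noise (EuclideanSpace ℝ (Fin K)) (plrEps C.lowᶜ.card C.ε C.lamHigh))

/-- PST-F as a randomized mechanism: the law of its output on the data set `D`. -/
def pstf (D : Fin n → Sample d) : Measure ((∀ k, Block C.block k) × EuclideanSpace ℝ (Fin K)) :=
  C.noiseLaw.map (C.output D)

end Config

end PrivateStacking

end

/-!
Changing one sample of a regularized empirical risk changes the minimizer, but the change can be
compensated in the noise: `w` minimizes the risk without a sample `x` at noise `b` if and only if
it minimizes the risk with that sample at noise `b - ℓ'(wᵀ x) x`. The minimizer of a `μ`-strongly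
convex risk of `N` samples is `1 / (N μ)`-Lipschitz in the noise, so this compensation is a shear
of the noise along `x` that is Lipschitz with constant `1 + q² / (4 N μ)` on every line parallel to
`x`, where `q` bounds the norm of `x`. Hence it distorts Lebesgue measure by at most that factor;
neither injectivity nor differentiability is involved. Since it moves the noise by at most `q`, it
changes the density of the noise by a factor of at most `e^(ε q / 2)`. Replacing a sample takes two
shears, one that removes the old sample and one that adds the new one, and the budgets are
calibrated such that the product of all these factors is at most `e^ε`. In stacking, a sample of
the low-level data influences only the law of the low-level models, and a sample of the high-level
data only the conditional law of the high-level model, so the full budget is available for each.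
-/

noncomputable section

namespace PrivateStacking

open Filter Function Set
open scoped ENNReal NNReal Topology

/-! ### Domination of measures under shears -/

lemma hausdorffMeasure_le_smul_map {X Y : Type*} [EMetricSpace X] [MeasurableSpace X]
    [BorelSpace X] [EMetricSpace Y] [MeasurableSpace Y] [BorelSpace Y] {κ : ℝ≥0} {τ : X → Y}
    {s : ℝ} (hs : 0 ≤ s) (hτ : LipschitzWith κ τ) (hsurj : Surjective τ) :
    (μH[s] : Measure Y) ≤ (κ : ℝ≥0∞) ^ s • (μH[s] : Measure X).map τ := by
  refine Measure.le_iff.2 fun S hS => ?_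
  rw [Measure.smul_apply, Measure.map_apply hτ.continuous.measurable hS, smul_eq_mul]
  nth_rw 1 [← image_preimage_eq S hsurj]
  exact hτ.lipschitzOnWith.hausdorffMeasure_image_le hs

lemma surjective_id_add_of_bounded {h : ℝ → ℝ} {B : ℝ} (hc : Continuous h) (hB : ∀ t, |h t| ≤ B) :
    Surjective fun t => t + h t :=
  (continuous_id.add hc).surjective
    (tendsto_atTop_add_right_of_le _ (-B) tendsto_id fun t => (abs_le.1 (hB t)).1)
    (tendsto_atBot_add_right_of_ge _ B tendsto_id fun t => (abs_le.1 (hB t)).2)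

lemma setLIntegral_Icc_le_mul_setLIntegral_add {κ : ℝ≥0} {h : ℝ → ℝ} {B : ℝ}
    (hB : ∀ t, |h t| ≤ B) (hlip : LipschitzWith κ fun t => t + h t) {f : ℝ → ℝ≥0∞}
    (hf : Measurable f) (a b : ℝ) :
    ∫⁻ t in Icc a b, f t ≤ κ * ∫⁻ t in Icc (a - B) (b + B), f (t + h t) := by
  have hc : Continuous h := by
    simpa [Pi.sub_def] using hlip.continuous.sub continuous_id'
  have hle : (volume : Measure ℝ) ≤ (κ : ℝ≥0∞) • volume.map fun t => t + h t := by
    simpa [hausdorffMeasure_real] using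
      hausdorffMeasure_le_smul_map zero_le_one hlip (surjective_id_add_of_bounded hc hB)
  have hsub : (fun t => t + h t) ⁻¹' Icc a b ⊆ Icc (a - B) (b + B) := fun t ht => by
    have := abs_le.1 (hB t)
    exact ⟨by linarith [ht.1], by linarith [ht.2]⟩
  calc ∫⁻ t in Icc a b, f t
      ≤ ∫⁻ t in Icc a b, f t ∂((κ : ℝ≥0∞) • volume.map fun t => t + h t) :=
        lintegral_mono' (Measure.restrict_mono le_rfl hle) le_rfl
    _ = κ * ∫⁻ t in (fun t => t + h t) ⁻¹' Icc a b, f (t + h t) := by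
        rw [Measure.restrict_smul, lintegral_smul_measure, smul_eq_mul,
          setLIntegral_map measurableSet_Icc hf hlip.continuous.measurable]
    _ ≤ κ * ∫⁻ t in Icc (a - B) (b + B), f (t + h t) := by gcongr

lemma lintegral_lintegral_add_right {G T : Type*} [AddGroup G] [MeasurableSpace G]
    [MeasurableAdd₂ G] [MeasurableSpace T] (μ : Measure G) [SFinite μ] [μ.IsAddRightInvariant]
    (ν : Measure T) [SFinite ν] {f : G → ℝ≥0∞} (hf : Measurable f) {u : T → G}
    (hu : Measurable u) :
    ∫⁻ b, ∫⁻ t, f (b + u t) ∂ν ∂μ = ν univ * ∫⁻ b, f b ∂μ := by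
  rw [lintegral_lintegral_swap (by fun_prop)]
  simp only [lintegral_add_right_eq_self f, lintegral_const, mul_comm]

lemma le_of_forall_natCast_mul_le {a b c : ℝ≥0∞} (hb : b ≠ ⊤)
    (h : ∀ R : ℕ, R * a ≤ (R + b) * c) : a ≤ c := by
  by_contra! hca
  have hc : c ≠ ⊤ := hca.ne_top
  obtain ⟨R, hR⟩ := ENNReal.exists_nat_mul_gt (tsub_pos_of_lt hca).ne' (ENNReal.mul_ne_top hb hc)
  refine hR.not_ge ?_
  rw [ENNReal.mul_sub fun _ _ => ENNReal.natCast_ne_top R, tsub_le_iff_right, add_comm, ← add_mul]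
  exact h R

section Shear

variable {E : Type*} [AddCommGroup E] [Module ℝ E] [MeasurableSpace E] [MeasurableAdd₂ E]
  [MeasurableSMul₂ ℝ E]

-- Fubini over segments of length `R` parallel to `v` reduces to the line; `R → ∞` absorbs the
-- boundary effect.
lemma le_smul_map_shear (μ : Measure E) [SFinite μ] [μ.IsAddRightInvariant] {κ : ℝ≥0} {h : E → ℝ}
    {v : E} {B : ℝ} (hm : Measurable h) (hB : ∀ b, |h b| ≤ B)
    (hlip : ∀ b, LipschitzWith κ fun t : ℝ => t + h (b + t • v)) :
    μ ≤ (κ : ℝ≥0∞) • μ.map fun b => b + h b • v := by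
  have hB0 : 0 ≤ B := (abs_nonneg _).trans (hB 0)
  have hT : Measurable fun b => b + h b • v := by fun_prop
  refine Measure.le_iff.2 fun S hS =>
    le_of_forall_natCast_mul_le (b := ENNReal.ofReal (2 * B)) ENNReal.ofReal_ne_top fun R => ?_
  have hf : Measurable (S.indicator (1 : E → ℝ≥0∞)) := measurable_one.indicator hS
  calc R * μ S = ∫⁻ b, (∫⁻ t in Icc (0 : ℝ) R, S.indicator 1 (b + t • v)) ∂μ := by
        rw [lintegral_lintegral_add_right μ _ hf (by fun_prop), lintegral_indicator_one hS]
        simp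
    _ ≤ ∫⁻ b, κ * (∫⁻ t in Icc (0 - B) (R + B),
          S.indicator 1 (b + t • v + h (b + t • v) • v)) ∂μ := by
        gcongr with b
        simpa only [add_smul, ← add_assoc] using
          setLIntegral_Icc_le_mul_setLIntegral_add (fun t => hB (b + t • v)) (hlip b)
            (f := fun t => S.indicator 1 (b + t • v)) (by fun_prop) 0 R
    _ = (R + ENNReal.ofReal (2 * B)) * ((κ : ℝ≥0∞) • μ.map fun b => b + h b • v) S := by
        rw [lintegral_const_mul' _ _ ENNReal.coe_ne_top,
          lintegral_lintegral_add_right μ _ (f := fun b => S.indicator 1 (b + h b • v))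
            (hf.comp hT) (by fun_prop), ← lintegral_map hf hT, lintegral_indicator_one hS,
          Measure.restrict_apply_univ, Real.volume_Icc,
          show (R + B - (0 - B) : ℝ) = R + 2 * B by ring,
          ENNReal.ofReal_add R.cast_nonneg (by positivity), ENNReal.ofReal_natCast,
          Measure.smul_apply, smul_eq_mul, mul_left_comm]

end Shear

lemma withDensity_le_smul_map {X : Type*} [MeasurableSpace X] {μ : Measure X} {κ c : ℝ≥0∞}
    {p : X → ℝ≥0∞} {T : X → X} (hp : Measurable p) (hT : Measurable T) (hμ : μ ≤ κ • μ.map T)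
    (hc : ∀ b, p (T b) ≤ c * p b) :
    μ.withDensity p ≤ (κ * c) • (μ.withDensity p).map T := by
  refine Measure.le_iff.2 fun S hS => ?_
  calc μ.withDensity p S = ∫⁻ b in S, p b ∂μ := withDensity_apply _ hS
    _ ≤ ∫⁻ b in S, p b ∂(κ • μ.map T) := lintegral_mono' (Measure.restrict_mono le_rfl hμ) le_rfl
    _ = κ * ∫⁻ b in T ⁻¹' S, p (T b) ∂μ := by
        rw [Measure.restrict_smul, lintegral_smul_measure, smul_eq_mul, setLIntegral_map hS hp hT]
    _ ≤ κ * ∫⁻ b in T ⁻¹' S, c * p b ∂μ := by gcongr with b; exact hc b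
    _ = ((κ * c) • (μ.withDensity p).map T) S := by
        rw [lintegral_const_mul _ hp, Measure.smul_apply, Measure.map_apply hT hS,
          withDensity_apply _ (hT hS), smul_eq_mul, mul_assoc]

/-! ### The noise -/

lemma integrable_exp_neg_mul_norm {E : Type*} [NormedAddCommGroup E] [NormedSpace ℝ E]
    [FiniteDimensional ℝ E] [MeasurableSpace E] [BorelSpace E] (μ : Measure E) [μ.IsAddHaarMeasure]
    {a : ℝ} (ha : 0 < a) : Integrable (fun b : E => Real.exp (-a * ‖b‖)) μ := by
  set r : ℝ := Module.finrank ℝ E + 1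
  have hnorm : Tendsto (fun b : E => 1 + ‖b‖) (cocompact E) atTop :=
    tendsto_atTop_add_const_left _ 1 tendsto_norm_cocompact_atTop
  have hO : (fun b : E => Real.exp (-a * ‖b‖)) =O[cocompact E] fun b => (1 + ‖b‖) ^ (-r) := by
    refine (((isLittleO_exp_neg_mul_rpow_atTop ha (-r)).comp_tendsto hnorm).isBigO.const_mul_left
      (Real.exp a)).congr_left fun b => ?_
    rw [comp_apply, ← Real.exp_add]
    ring_nf
  exact (Continuous.locallyIntegrable (by fun_prop)).integrable_of_isBigO_cocompact hO
    ((integrable_one_add_norm (lt_add_one _)).integrableAtFilter _)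

section Noise

variable {E : Type*} [NormedAddCommGroup E] [NormedSpace ℝ E] [FiniteDimensional ℝ E]
  [MeasureSpace E] [BorelSpace E] [(volume : Measure E).IsAddHaarMeasure]

lemma isProbabilityMeasure_noise {ε : ℝ} (hε : 0 < ε) : IsProbabilityMeasure (noise E ε) := by
  have hint : Integrable fun b : E => Real.exp (-(ε * ‖b‖ / 2)) := by
    simpa only [neg_mul, div_mul_eq_mul_div] using
      integrable_exp_neg_mul_norm (volume : Measure E) (half_pos hε)
  have hpos : 0 < ∫⁻ b : E, ENNReal.ofReal (Real.exp (-(ε * ‖b‖ / 2))) := by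
    rw [lintegral_pos_iff_support (by fun_prop)]
    simp [support, Real.exp_pos, NeZero.pos]
  constructor
  rw [noise, Measure.smul_apply, withDensity_apply _ .univ, Measure.restrict_univ, smul_eq_mul,
    ENNReal.inv_mul_cancel hpos.ne' hint.lintegral_lt_top.ne]

lemma noise_le_smul_map_shear {κ : ℝ≥0} {ε r B : ℝ} (hε : 0 ≤ ε) {h : E → ℝ} {v : E}
    (hm : Measurable h) (hB : ∀ b, |h b| ≤ B) (hr : ∀ b, ‖h b • v‖ ≤ r)
    (hlip : ∀ b, LipschitzWith κ fun t : ℝ => t + h (b + t • v)) :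
    noise E ε ≤ ENNReal.ofReal (κ * Real.exp (ε * r / 2)) •
      (noise E ε).map fun b => b + h b • v := by
  have hp : Measurable fun b : E => ENNReal.ofReal (Real.exp (-(ε * ‖b‖ / 2))) := by fun_prop
  rw [noise, ← withDensity_smul _ hp, ENNReal.ofReal_mul κ.coe_nonneg, ENNReal.ofReal_coe_nnreal]
  refine withDensity_le_smul_map (hp.const_smul _) (by fun_prop)
    (le_smul_map_shear _ hm hB hlip) fun b => ?_
  simp only [Pi.smul_apply, smul_eq_mul]
  rw [mul_left_comm, ← ENNReal.ofReal_mul (Real.exp_pos _).le, ← Real.exp_add]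
  have htri : ‖b‖ ≤ ‖b + h b • v‖ + r := by
    simpa using (norm_sub_le (b + h b • v) (h b • v)).trans (add_le_add_right (hr b) _)
  gcongr
  nlinarith

end Noise

/-! ### Minimizers of convex functions -/

section Minimizer

variable {E : Type*} [NormedAddCommGroup E] [NormedSpace ℝ E] {f f' F φ : E → ℝ} {μ : ℝ}

lemma IsMinimizer.add_sq_le (hf : StrongConvexOn univ μ f) {w : E} (hw : IsMinimizer f w)
    (u : E) : f w + μ / 2 * ‖u - w‖ ^ 2 ≤ f u := by
  have hsegment : ∀ t ∈ Ioo (0 : ℝ) 1, f w + (1 - t) * (μ / 2 * ‖u - w‖ ^ 2) ≤ f u := by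
    rintro t ⟨ht0, ht1⟩
    have hconv := (hw _).trans
      (hf.2 (mem_univ u) (mem_univ w) ht0.le (sub_nonneg.2 ht1.le) (add_sub_cancel _ _))
    simp only [smul_eq_mul] at hconv
    refine le_of_mul_le_mul_left ?_ ht0
    linarith
  have hlim : Tendsto (fun t : ℝ => f w + (1 - t) * (μ / 2 * ‖u - w‖ ^ 2)) (𝓝[>] 0)
      (𝓝 (f w + (1 - 0) * (μ / 2 * ‖u - w‖ ^ 2))) :=
    (Continuous.tendsto (by fun_prop) _).mono_left nhdsWithin_le_nhds
  simpa using le_of_tendsto hlim (mem_of_superset (Ioo_mem_nhdsGT one_pos) hsegment)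

lemma IsMinimizer.mul_sq_norm_sub_le (hf : StrongConvexOn univ μ f)
    (hf' : StrongConvexOn univ μ f') {w w' : E} (hw : IsMinimizer f w) (hw' : IsMinimizer f' w') :
    μ * ‖w - w'‖ ^ 2 ≤ (f w' - f' w') - (f w - f' w) := by
  have hgrowth := hw.add_sq_le hf w'
  have hgrowth' := hw'.add_sq_le hf' w
  rw [norm_sub_rev] at hgrowth
  linarith

lemma IsMinimizer.add_fderiv (hF : ConvexOn ℝ univ F) {φ' : E →L[ℝ] ℝ} {w : E}
    (hφ : HasFDerivAt φ φ' w) (hw : IsMinimizer (fun u => F u + φ u) w) :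
    IsMinimizer (fun u => F u + φ' u) w := by
  intro u
  have hmin : IsMinOn (fun t : ℝ => φ (w + t • (u - w)) + t * (F u - F w)) (Icc 0 1) 0 := by
    rintro t ⟨ht0, ht1⟩
    have hconv := hF.2 (mem_univ u) (mem_univ w) ht0 (sub_nonneg.2 ht1) (add_sub_cancel _ _)
    have hle := hw (w + t • (u - w))
    rw [show t • u + (1 - t) • w = w + t • (u - w) by module] at hconv
    simp only [smul_eq_mul, mem_ofPred_eq, zero_smul, zero_mul, add_zero] at hconv hle ⊢
    linarith
  have hline : HasDerivAt (fun t : ℝ => w + t • (u - w)) (u - w) 0 := by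
    simpa using ((hasDerivAt_id (0 : ℝ)).smul_const (u - w)).const_add w
  have hderiv : HasDerivAt (fun t : ℝ => φ (w + t • (u - w)) + t * (F u - F w))
      (φ' (u - w) + (F u - F w)) 0 := by
    refine (HasFDerivAt.comp_hasDerivAt 0 (by simpa using hφ) hline).add ?_
    simpa using (hasDerivAt_id (0 : ℝ)).mul_const (F u - F w)
  have hnonneg := hmin.localize.hasFDerivWithinAt_nonneg
    hderiv.hasFDerivAt.hasFDerivWithinAt (y := 1)
    (mem_posTangentConeAt_of_segment_subset (by simp [segment_eq_Icc]))
  simp only [ContinuousLinearMap.toSpanSingleton_apply, one_smul, map_sub] at hnonneg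
  linarith

lemma isMinimizer_sub_fderiv (hφ : ConvexOn ℝ univ φ) {φ' : E →L[ℝ] ℝ} {w : E}
    (hφ' : HasFDerivAt φ φ' w) : IsMinimizer (fun u => φ u - φ' u) w := by
  simpa [← sub_eq_add_neg] using
    IsMinimizer.add_fderiv hφ hφ'.neg fun u => by simp

lemma isMinimizer_add_fderiv_iff (hF : ConvexOn ℝ univ F) (hφ : ConvexOn ℝ univ φ)
    {φ' : E →L[ℝ] ℝ} {w : E} (hφ' : HasFDerivAt φ φ' w) :
    IsMinimizer (fun u => F u + φ' u) w ↔ IsMinimizer (fun u => F u + φ u) w := by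
  refine ⟨fun hw u => ?_, fun hw => hw.add_fderiv hF hφ'⟩
  have hlinear := hw u
  have htangent := isMinimizer_sub_fderiv hφ hφ' u
  linarith

lemma continuous_of_isMinimizer [ProperSpace E] {P : Type*} [TopologicalSpace P]
    {f : P → E → ℝ} (hf : Continuous (uncurry f)) (hconv : ∀ p, StrictConvexOn ℝ univ (f p))
    {m : P → E} (hm : ∀ p, IsMinimizer (f p) (m p)) : Continuous m := by
  refine continuous_iff_continuousAt.2 fun p₀ => Metric.tendsto_nhds.2 fun r hr => ?_
  have hsphere : ∀ᶠ p in 𝓝 p₀, ∀ u ∈ Metric.sphere (m p₀) r, f p (m p₀) < f p u := by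
    refine (isCompact_sphere _ _).eventually_forall_of_forall_eventually fun u hu => ?_
    have hlt : f p₀ (m p₀) < f p₀ u := (hm p₀ u).lt_of_ne fun heq =>
      Metric.ne_of_mem_sphere hu hr.ne' <| (hconv p₀).eq_of_isMinOn
        (isMinOn_univ_iff.2 fun v => heq ▸ hm p₀ v) (isMinOn_univ_iff.2 (hm p₀)) trivial trivial
    have hconst : Continuous fun z : P × E => f z.1 (m p₀) :=
      hf.comp (continuous_fst.prodMk continuous_const)
    exact hconst.continuousAt.eventually_lt hf.continuousAt hlt
  filter_upwards [hsphere] with p hp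
  by_contra! hfar
  set u : E := AffineMap.lineMap (m p₀) (m p) (r / dist (m p) (m p₀))
  have hpos : 0 < dist (m p) (m p₀) := hr.trans_le hfar
  have hu : u ∈ Metric.sphere (m p₀) r := by
    rw [mem_sphere_iff_norm, ← dist_eq_norm, dist_lineMap_left, Real.norm_of_nonneg (by positivity),
      dist_comm (m p₀), div_mul_cancel₀ _ hpos.ne']
  have hle := (hconv p).convexOn.le_max_of_mem_segment (mem_univ (m p₀)) (mem_univ (m p))
    (lineMap_mem_segment ℝ _ _ ⟨by positivity, (div_le_one hpos).2 hfar⟩ : u ∈ segment ℝ _ _)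
  rw [max_eq_left (hm p _)] at hle
  exact (hp u hu).not_ge hle

lemma continuous_of_convexOn [FiniteDimensional ℝ E] (hf : ConvexOn ℝ univ f) : Continuous f :=
  continuousOn_univ.1 (hf.continuousOn isOpen_univ)

end Minimizer

section StrongConvex

variable {E : Type*} [NormedAddCommGroup E] [InnerProductSpace ℝ E] [FiniteDimensional ℝ E]
  {f : E → ℝ} {μ : ℝ}

lemma tendsto_atTop_of_strongConvexOn (hf : StrongConvexOn univ μ f) (hμ : 0 < μ) :
    Tendsto f (cocompact E) atTop := by
  have hconv := strongConvexOn_iff_convex.1 hf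
  obtain ⟨l, c, hle, -⟩ := hconv.exists_affine_le_of_lt (𝕜 := ℝ) (mem_univ 0) (sub_one_lt _)
    isClosed_univ ((continuous_of_convexOn hconv).lowerSemicontinuous.lowerSemicontinuousOn _)
  have hbound : ∀ u, (μ / 2 * ‖u‖ + -‖l‖) * ‖u‖ + c ≤ f u := fun u => by
    have hu := hle ⟨u, mem_univ u⟩
    have hlu := (abs_le.1 (l.le_opNorm u)).1
    simp only [Pi.add_apply, domRestrict_apply, comp_apply, RCLike.re_to_real, const_apply] at hu
    linarith
  refine tendsto_atTop_mono hbound (tendsto_atTop_add_const_right _ c ?_)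
  have hnorm := tendsto_norm_cocompact_atTop (E := E)
  exact (tendsto_atTop_add_const_right _ _ (hnorm.const_mul_atTop (half_pos hμ))).atTop_mul_atTop₀
    hnorm

lemma existsUnique_isMinimizer (hf : StrongConvexOn univ μ f) (hμ : 0 < μ) :
    ∃! w, IsMinimizer f w := by
  have hconv := hf.strictConvexOn hμ
  obtain ⟨w, hw⟩ := (continuous_of_convexOn hconv.convexOn).exists_forall_le
    (tendsto_atTop_of_strongConvexOn hf hμ)
  exact ⟨w, hw, fun u hu =>
    hconv.eq_of_isMinOn (isMinOn_univ_iff.2 hu) (isMinOn_univ_iff.2 hw) trivial trivial⟩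

lemma isMinimizer_argmin (hf : StrongConvexOn univ μ f) (hμ : 0 < μ) : IsMinimizer f (argmin f) :=
  Classical.epsilon_spec (existsUnique_isMinimizer hf hμ).exists

lemma IsMinimizer.argmin_eq (hf : StrongConvexOn univ μ f) (hμ : 0 < μ) {w : E}
    (hw : IsMinimizer f w) : argmin f = w :=
  (existsUnique_isMinimizer hf hμ).unique (isMinimizer_argmin hf hμ) hw

end StrongConvex

/-! ### The logistic loss -/

/-- A convex loss with derivative bounded by `B` and `L`-Lipschitz, as a function of the
prediction. This is all that objective perturbation uses of the loss of a single sample. -/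
structure IsSmoothLoss (ψ : ℝ → ℝ) (B : ℝ) (L : ℝ≥0) : Prop where
  convexOn : ConvexOn ℝ univ ψ
  differentiable : Differentiable ℝ ψ
  abs_deriv_le : ∀ t, |deriv ψ t| ≤ B
  lipschitzWith_deriv : LipschitzWith L (deriv ψ)

lemma hasDerivAt_logLoss (y t : ℝ) :
    HasDerivAt (fun t => logLoss t y) (-y * Real.sigmoid (-y * t)) t := by
  have hexp := ((hasDerivAt_id t).const_mul (-y)).exp.const_add 1
  refine (hexp.log (by positivity)).congr_deriv ?_
  rw [Real.sigmoid_def, Real.exp_neg]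
  simp only [id_eq]
  field_simp
  ring

lemma deriv_logLoss (y : ℝ) :
    deriv (fun t => logLoss t y) = fun t => -y * Real.sigmoid (-y * t) :=
  deriv_eq (hasDerivAt_logLoss y)

lemma hasDerivAt_deriv_logLoss (y t : ℝ) : HasDerivAt (deriv fun t => logLoss t y)
    (y ^ 2 * (Real.sigmoid (-y * t) * (1 - Real.sigmoid (-y * t)))) t := by
  rw [deriv_logLoss]
  have hcomp := (Real.hasDerivAt_sigmoid (-y * t)).comp t ((hasDerivAt_id t).const_mul (-y))
  exact (hcomp.const_mul (-y)).congr_deriv (by ring)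

lemma differentiable_logLoss (y : ℝ) : Differentiable ℝ fun t => logLoss t y := fun t =>
  (hasDerivAt_logLoss y t).differentiableAt

lemma differentiable_deriv_logLoss (y : ℝ) : Differentiable ℝ (deriv fun t => logLoss t y) :=
  fun t => (hasDerivAt_deriv_logLoss y t).differentiableAt

lemma deriv2_logLoss_nonneg (y t : ℝ) : 0 ≤ deriv (deriv fun t => logLoss t y) t := by
  rw [(hasDerivAt_deriv_logLoss y t).deriv]
  exact mul_nonneg (sq_nonneg y)
    (mul_nonneg (Real.sigmoid_nonneg _) (sub_nonneg.2 (Real.sigmoid_le_one _)))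

lemma convexOn_logLoss (y : ℝ) : ConvexOn ℝ univ fun t => logLoss t y :=
  (monotone_of_deriv_nonneg (differentiable_deriv_logLoss y)
    (deriv2_logLoss_nonneg y)).convexOn_univ_of_deriv (differentiable_logLoss y)

lemma isSmoothLoss_logLoss {y : ℝ} (hy : |y| ≤ 1) :
    IsSmoothLoss (fun t => logLoss t y) 1 (1 / 4) := by
  refine ⟨convexOn_logLoss y, differentiable_logLoss y, fun t => ?_,
    lipschitzWith_of_nnnorm_deriv_le (differentiable_deriv_logLoss y) fun t => ?_⟩
  · rw [deriv_logLoss, abs_mul, abs_neg, abs_of_pos (Real.sigmoid_pos _)]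
    exact mul_le_one₀ hy (Real.sigmoid_nonneg _) (Real.sigmoid_le_one _)
  · rw [← NNReal.coe_le_coe, coe_nnnorm, Real.norm_of_nonneg (deriv2_logLoss_nonneg y t),
      (hasDerivAt_deriv_logLoss y t).deriv]
    have hy2 : y ^ 2 ≤ 1 := (sq_le_one_iff_abs_le_one y).2 hy
    push_cast
    nlinarith [sq_nonneg (Real.sigmoid (-y * t) - 1 / 2), sq_nonneg y]

/-! ### Objective perturbation -/

lemma strongConvexOn_convexOn_add {E : Type*} [NormedAddCommGroup E] [NormedSpace ℝ E] {s : Set E}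
    {f g : E → ℝ} {μ : ℝ} (hf : ConvexOn ℝ s f) (hg : StrongConvexOn s μ g) :
    StrongConvexOn s μ fun w => f w + g w := by
  simpa [StrongConvexOn, Pi.add_def] using (uniformConvexOn_zero.2 hf).add hg

lemma lipschitzWith_add_comp_line {E : Type*} [NormedAddCommGroup E] [NormedSpace ℝ E] {h : E → ℝ}
    {κ : ℝ≥0} (hh : LipschitzWith κ h) (b v : E) :
    LipschitzWith (1 + κ * ‖v‖₊) fun t : ℝ => t + h (b + t • v) := by
  have hline : LipschitzWith ‖v‖₊ fun t : ℝ => b + t • v :=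
    LipschitzWith.of_dist_le_mul fun t t' => by
      rw [dist_add_left, dist_eq_norm, ← sub_smul, norm_smul, mul_comm, coe_nnnorm, dist_eq_norm]
  exact LipschitzWith.id.add (hh.comp hline)

section Perturb

variable {E : Type*} [NormedAddCommGroup E] [InnerProductSpace ℝ E] {F F' : E → ℝ} {N μ : ℝ}

/-- The objective `F` perturbed by the noise vector `b`, for a data set of `N` samples. -/
def perturb (N : ℝ) (F : E → ℝ) (b w : E) : ℝ := F w + inner ℝ b w / N

lemma strongConvexOn_perturb (hF : StrongConvexOn univ μ F) (b : E) :
    StrongConvexOn univ μ (perturb N F b) := by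
  have hlin : ConvexOn ℝ univ fun w : E => inner ℝ b w / N := by
    simpa [div_eq_inv_mul, Pi.smul_def] using (N⁻¹ • innerSL ℝ b).toLinearMap.convexOn convex_univ
  have hadd := strongConvexOn_convexOn_add hlin hF
  simp only [add_comm] at hadd
  exact hadd

lemma convexOn_perturb (hF : ConvexOn ℝ univ F) (b : E) : ConvexOn ℝ univ (perturb N F b) :=
  strongConvexOn_zero.1 (strongConvexOn_perturb (strongConvexOn_zero.2 hF) b)

lemma convexOn_comp_inner_div {ψ : ℝ → ℝ} (hψ : ConvexOn ℝ univ ψ) (x : E) (hN : 0 ≤ N) :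
    ConvexOn ℝ univ fun u : E => ψ (inner ℝ u x) / N := by
  simpa [div_eq_inv_mul, real_inner_comm, Pi.smul_def] using
    (hψ.comp_linearMap (innerSL ℝ x).toLinearMap).smul (inv_nonneg.2 hN)

lemma isMinimizer_perturb_add_iff (hN : 0 ≤ N) (hF : ConvexOn ℝ univ F) {ψ : ℝ → ℝ}
    (hψ : ConvexOn ℝ univ ψ) {b w x : E} {s : ℝ} (hs : HasDerivAt ψ s (inner ℝ w x)) :
    IsMinimizer (perturb N F b) w ↔
      IsMinimizer (perturb N (fun u => F u + ψ (inner ℝ u x) / N) (b - s • x)) w := by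
  have hconv := convexOn_comp_inner_div hψ x hN
  have hderiv : HasFDerivAt (fun u : E => ψ (inner ℝ u x) / N) (N⁻¹ • s • innerSL ℝ x) w := by
    have hinner : HasFDerivAt (fun u : E => inner ℝ u x) (innerSL ℝ x) w := by
      rw [show (fun u => inner ℝ u x) = innerSL ℝ x from funext fun u => real_inner_comm x u]
      exact (innerSL ℝ x).hasFDerivAt
    simpa only [div_eq_inv_mul] using! (hs.comp_hasFDerivAt w hinner).const_mul N⁻¹
  convert isMinimizer_add_fderiv_iff (convexOn_perturb hF (b - s • x)) hconv hderiv using 2 <;>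
  · funext u
    simp [perturb, inner_sub_left, real_inner_smul_left]
    ring

variable [FiniteDimensional ℝ E]

lemma lipschitzWith_argmin_perturb (hN : 0 < N) (hμ : 0 < μ) (hF : StrongConvexOn univ μ F) :
    LipschitzWith (N * μ)⁻¹.toNNReal fun b => argmin (perturb N F b) := by
  refine LipschitzWith.of_dist_le_mul fun b b' => ?_
  have hmin := fun b => isMinimizer_argmin (strongConvexOn_perturb (N := N) hF b) hμ
  have hle := (hmin b).mul_sq_norm_sub_le (strongConvexOn_perturb hF b)
    (strongConvexOn_perturb hF b') (hmin b')
  rw [Real.coe_toNNReal _ (by positivity), dist_eq_norm, dist_eq_norm, inv_mul_eq_div,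
    le_div_iff₀ (by positivity)]
  set w := argmin (perturb N F b)
  set w' := argmin (perturb N F b')
  have hdiff : perturb N F b w' - perturb N F b' w' - (perturb N F b w - perturb N F b' w)
      = -inner ℝ (b - b') (w - w') / N := by
    simp only [perturb, inner_sub_left, inner_sub_right]
    ring
  rw [hdiff, le_div_iff₀ hN] at hle
  have hcauchy := (abs_le.1 (abs_real_inner_le_norm (b - b') (w - w'))).1
  rcases (norm_nonneg (w - w')).eq_or_lt with hzero | hpos
  · rw [← hzero, zero_mul]
    positivity
  · refine le_of_mul_le_mul_right ?_ hpos
    linarith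

lemma lipschitzWith_inner_argmin_perturb (hN : 0 < N) (hμ : 0 < μ) (hF : StrongConvexOn univ μ F)
    (x : E) : LipschitzWith (‖x‖₊ * (N * μ)⁻¹.toNNReal)
      fun b => inner ℝ (argmin (perturb N F b)) x := by
  have hinner : LipschitzWith ‖x‖₊ fun u : E => inner ℝ u x :=
    LipschitzWith.of_dist_le_mul fun u u' => by
      rw [Real.dist_eq, ← inner_sub_left, dist_eq_norm, mul_comm]
      exact abs_real_inner_le_norm _ _
  exact hinner.comp (lipschitzWith_argmin_perturb hN hμ hF)

variable [MeasureSpace E] [BorelSpace E] [(volume : Measure E).IsAddHaarMeasure]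

lemma map_noise_argmin_perturb_le {ε q B : ℝ} {L : ℝ≥0} (hN : 0 < N) (hμ : 0 < μ) (hε : 0 ≤ ε)
    {s : ℝ → ℝ} (hs : LipschitzWith L s) (hB : ∀ t, |s t| ≤ B) {x : E} (hx : ‖x‖ ≤ q)
    (hF : StrongConvexOn univ μ F) (hF' : StrongConvexOn univ μ F')
    (hconj : ∀ b w, IsMinimizer (perturb N F b) w →
      IsMinimizer (perturb N F' (b + s (inner ℝ w x) • x)) w) :
    (noise E ε).map (fun b => argmin (perturb N F' b)) ≤
      ENNReal.ofReal ((1 + L * q ^ 2 / (N * μ)) * Real.exp (ε * (B * q) / 2)) •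
        (noise E ε).map (fun b => argmin (perturb N F b)) := by
  have hm' := (lipschitzWith_argmin_perturb hN hμ hF').continuous.measurable
  set h : E → ℝ := fun b => s (inner ℝ (argmin (perturb N F b)) x)
  have hh : LipschitzWith (L * (‖x‖₊ * (N * μ)⁻¹.toNNReal)) h :=
    hs.comp (lipschitzWith_inner_argmin_perturb hN hμ hF x)
  have hκ : 0 ≤ 1 + L * q ^ 2 / (N * μ) := by positivity
  have hshear : ∀ b, LipschitzWith (1 + L * q ^ 2 / (N * μ)).toNNReal
      fun t : ℝ => t + h (b + t • x) := fun b => by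
    refine (lipschitzWith_add_comp_line hh b x).weaken ?_
    rw [← NNReal.coe_le_coe, Real.coe_toNNReal _ hκ]
    push_cast
    rw [Real.coe_toNNReal _ (by positivity)]
    have hxq : ‖x‖ ^ 2 ≤ q ^ 2 := by gcongr
    calc (1 : ℝ) + L * (‖x‖ * (N * μ)⁻¹) * ‖x‖ = 1 + L * ‖x‖ ^ 2 / (N * μ) := by ring
      _ ≤ 1 + L * q ^ 2 / (N * μ) := by gcongr
  have hmove : ∀ b, ‖h b • x‖ ≤ B * q := fun b => by
    rw [norm_smul]
    exact mul_le_mul (hB _) hx (norm_nonneg x) ((abs_nonneg _).trans (hB 0))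
  have hnoise := noise_le_smul_map_shear hε hh.continuous.measurable (fun b => hB _) hmove hshear
  have hargmin : ∀ b, argmin (perturb N F' (b + h b • x)) = argmin (perturb N F b) := fun b =>
    (hconj b _ (isMinimizer_argmin (strongConvexOn_perturb hF b) hμ)).argmin_eq
      (strongConvexOn_perturb hF' _) hμ
  have hmap := Measure.map_mono hnoise hm'
  have hadd : Measurable fun b => b + h b • x :=
    measurable_id.add (hh.continuous.measurable.smul_const x)
  rw [Measure.map_smul, Measure.map_map hm' hadd, Real.coe_toNNReal _ hκ, comp_def] at hmap
  rwa [funext hargmin] at hmap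

lemma map_noise_argmin_replace_le {ε q B : ℝ} {L : ℝ≥0} (hN : 0 < N) (hμ : 0 < μ) (hε : 0 ≤ ε)
    (hF : StrongConvexOn univ μ F) {ψ ψ' : ℝ → ℝ} (hψ : IsSmoothLoss ψ B L)
    (hψ' : IsSmoothLoss ψ' B L) {x x' : E} (hx : ‖x‖ ≤ q) (hx' : ‖x'‖ ≤ q) :
    (noise E ε).map (fun b => argmin (perturb N (fun w => F w + ψ (inner ℝ w x) / N) b)) ≤
      ENNReal.ofReal ((1 + L * q ^ 2 / (N * μ)) ^ 2 * Real.exp (ε * (B * q))) •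
        (noise E ε).map
          (fun b => argmin (perturb N (fun w => F w + ψ' (inner ℝ w x') / N) b)) := by
  have hstrong : ∀ {φ : ℝ → ℝ} (z : E), IsSmoothLoss φ B L →
      StrongConvexOn univ μ fun w => F w + φ (inner ℝ w z) / N := fun {φ} z hφ => by
    have hadd := strongConvexOn_convexOn_add (convexOn_comp_inner_div hφ.convexOn z hN.le) hF
    simpa only [add_comm] using hadd
  have hconv := (hF.strictConvexOn hμ).convexOn
  have hremove := map_noise_argmin_perturb_le hN hμ hε hψ'.lipschitzWith_deriv hψ'.abs_deriv_le hx'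
    (hstrong x' hψ') hF fun b w hw => by
      rw [isMinimizer_perturb_add_iff hN.le hconv hψ'.convexOn (hψ'.differentiable _).hasDerivAt,
        add_sub_cancel_right]
      exact hw
  have hadd := map_noise_argmin_perturb_le hN hμ hε hψ.lipschitzWith_deriv.neg
    (fun t => (abs_neg _).trans_le (hψ.abs_deriv_le t)) hx hF (hstrong x hψ) fun b w hw => by
      rw [Pi.neg_apply, neg_smul, ← sub_eq_add_neg]
      exact (isMinimizer_perturb_add_iff hN.le hconv hψ.convexOn
        (hψ.differentiable _).hasDerivAt).1 hw
  refine hadd.trans ((_root_.smul_le_smul_left _ hremove).trans_eq ?_)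
  rw [smul_smul, ← ENNReal.ofReal_mul (by positivity), mul_mul_mul_comm, ← sq, ← Real.exp_add,
    add_halves]

end Perturb

section Objective

variable {ι E : Type*} [NormedAddCommGroup E] [InnerProductSpace ℝ E] {I : Finset ι} {i : ι}
  {x x' : ι → E} {y y' : ι → ℝ} {Δ lam : ℝ} {g r : E → ℝ}

/-- The empirical risk of the samples in `I`, regularized by `r`. The weight `1 / N` of a sample is
independent of `I`, so that a sample can be taken out of the sum. -/
def regularizedRisk (N : ℝ) (I : Finset ι) (x : ι → E) (y : ι → ℝ) (r : E → ℝ) (w : E) : ℝ :=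
  r w + ∑ i ∈ I, logLoss (inner ℝ w (x i)) (y i) / N

lemma regularizedRisk_eq_erase_add [DecidableEq ι] (hi : i ∈ I) (N : ℝ) (x : ι → E) (y : ι → ℝ)
    (r : E → ℝ) :
    regularizedRisk N I x y r = fun w =>
      regularizedRisk N (I.erase i) x y r w + logLoss (inner ℝ w (x i)) (y i) / N := by
  funext w
  rw [regularizedRisk, regularizedRisk, add_assoc, Finset.sum_erase_add _ _ hi]

lemma regularizedRisk_congr (hx : ∀ i ∈ I, x i = x' i) (hy : ∀ i ∈ I, y i = y' i) (N : ℝ)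
    (r : E → ℝ) : regularizedRisk N I x y r = regularizedRisk N I x' y' r := by
  funext w
  exact congrArg (r w + ·) (Finset.sum_congr rfl fun i hi => by rw [hx i hi, hy i hi])

lemma objective_eq_perturb (I : Finset ι) (x : ι → E) (y : ι → ℝ) (b : E) (Δ lam : ℝ) (g : E → ℝ) :
    objective I x y b Δ lam g = perturb I.card
      (regularizedRisk I.card I x y fun w => Δ * ‖w‖ ^ 2 / 2 + lam * g w) b := by
  funext w
  rw [objective, perturb, regularizedRisk, ← Finset.sum_div]
  ring

lemma objective_congr (hx : ∀ i ∈ I, x i = x' i) (hy : ∀ i ∈ I, y i = y' i) (b : E) (Δ lam : ℝ)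
    (g : E → ℝ) : objective I x y b Δ lam g = objective I x' y' b Δ lam g := by
  rw [objective_eq_perturb, objective_eq_perturb, regularizedRisk_congr hx hy]

lemma strongConvexOn_regularizer (Δ : ℝ) (hlam : 0 ≤ lam) (hg : StrongConvexOn univ 1 g) :
    StrongConvexOn univ (lam + Δ) fun w => Δ * ‖w‖ ^ 2 / 2 + lam * g w := by
  refine strongConvexOn_iff_convex.2 (((strongConvexOn_iff_convex.1 hg).smul hlam).congr ?_)
  intro w _
  simp only [smul_eq_mul]
  ring

lemma strongConvexOn_regularizedRisk {N μ : ℝ} (hN : 0 ≤ N) (hr : StrongConvexOn univ μ r)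
    (I : Finset ι) (x : ι → E) (y : ι → ℝ) :
    StrongConvexOn univ μ (regularizedRisk N I x y r) := by
  classical
  induction I using Finset.induction_on with
  | empty =>
    convert hr using 1
    funext w
    simp [regularizedRisk]
  | insert i I hi ih =>
    rw [regularizedRisk_eq_erase_add (Finset.mem_insert_self i I), Finset.erase_insert hi]
    simpa only [add_comm] using
      strongConvexOn_convexOn_add (convexOn_comp_inner_div (convexOn_logLoss (y i)) (x i) hN) ih

lemma strongConvexOn_objective (hlam : 0 ≤ lam) (hg : StrongConvexOn univ 1 g) (I : Finset ι)
    (x : ι → E) (y : ι → ℝ) (b : E) (Δ : ℝ) :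
    StrongConvexOn univ (lam + Δ) (objective I x y b Δ lam g) := by
  rw [objective_eq_perturb]
  exact strongConvexOn_perturb (strongConvexOn_regularizedRisk (Nat.cast_nonneg _)
    (strongConvexOn_regularizer Δ hlam hg) I x y) b

variable [FiniteDimensional ℝ E]

lemma continuous_argmin_objective (I : Finset ι) (y : ι → ℝ) (hlam : 0 ≤ lam) (hμ : 0 < lam + Δ)
    (hg : StrongConvexOn univ 1 g) :
    Continuous fun p : (ι → E) × E => argmin (objective I p.1 y p.2 Δ lam g) := by
  have hstrong := fun p : (ι → E) × E => strongConvexOn_objective hlam hg I p.1 y p.2 Δ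
  refine continuous_of_isMinimizer ?_ (fun p => (hstrong p).strictConvexOn hμ)
    fun p => isMinimizer_argmin (hstrong p) hμ
  have hloss : ∀ i, Continuous fun z : ((ι → E) × E) × E =>
      logLoss (inner ℝ z.2 (z.1.1 i)) (y i) := fun i =>
    (differentiable_logLoss (y i)).continuous.comp (by fun_prop)
  have hcont := continuous_of_convexOn (hg.strictConvexOn one_pos).convexOn
  simp only [uncurry_def, objective]
  fun_prop

/-- The cost in privacy of the two shears of the noise that replace a sample of norm at most `q`,
among `n` samples, in a `μ`-strongly convex objective. -/
def shearFactor (n : ℕ) (q μ : ℝ) : ℝ := (1 + q ^ 2 / (4 * n * μ)) ^ 2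

variable [MeasureSpace E] [BorelSpace E] [(volume : Measure E).IsAddHaarMeasure]

lemma map_noise_argmin_objective_le {ε q : ℝ} (hi : i ∈ I) (hxx' : ∀ j, j ≠ i → x j = x' j)
    (hyy' : ∀ j, j ≠ i → y j = y' j) (hx : ‖x i‖ ≤ q) (hx' : ‖x' i‖ ≤ q) (hy : |y i| ≤ 1)
    (hy' : |y' i| ≤ 1) (hε : 0 ≤ ε) (hlam : 0 ≤ lam) (hμ : 0 < lam + Δ)
    (hg : StrongConvexOn univ 1 g) :
    (noise E ε).map (fun b => argmin (objective I x y b Δ lam g)) ≤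
      ENNReal.ofReal (shearFactor I.card q (lam + Δ) * Real.exp (ε * q)) •
        (noise E ε).map (fun b => argmin (objective I x' y' b Δ lam g)) := by
  classical
  have hcard : (0 : ℝ) < I.card := Nat.cast_pos.2 (Finset.card_pos.2 ⟨i, hi⟩)
  have hreplace := map_noise_argmin_replace_le hcard hμ hε
    (strongConvexOn_regularizedRisk hcard.le (strongConvexOn_regularizer Δ hlam hg) (I.erase i) x y)
    (isSmoothLoss_logLoss hy) (isSmoothLoss_logLoss hy') hx hx'
  have hrest := regularizedRisk_congr (I := I.erase i)
    (fun j hj => hxx' j (Finset.ne_of_mem_erase hj))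
    (fun j hj => hyy' j (Finset.ne_of_mem_erase hj)) I.card
    fun w : E => Δ * ‖w‖ ^ 2 / 2 + lam * g w
  have hfactor : (1 + ((1 / 4 : ℝ≥0) : ℝ) * q ^ 2 / (I.card * (lam + Δ))) ^ 2
      = shearFactor I.card q (lam + Δ) := by
    rw [shearFactor]
    push_cast
    generalize lam + Δ = μ
    ring
  simp only [objective_eq_perturb, regularizedRisk_eq_erase_add hi, ← hrest]
  rwa [hfactor, one_mul] at hreplace

end Objective

/-! ### Product measures -/

section Product

lemma pi_le_smul_pi {ι : Type*} [Fintype ι] {α : ι → Type*} [∀ i, MeasurableSpace (α i)]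
    {μ ν : ∀ i, Measure (α i)} [∀ i, SigmaFinite (μ i)]
    {c : ι → ℝ≥0∞} (hc₀ : ∀ i, c i ≠ 0) (hc : ∀ i, c i ≠ ∞) (h : ∀ i, μ i ≤ c i • ν i) :
    Measure.pi μ ≤ (∏ i, c i) • Measure.pi ν := by
  have hprod₀ : ∏ i, c i ≠ 0 := Finset.prod_ne_zero_iff.2 fun i _ => hc₀ i
  have hprod : ∏ i, c i ≠ ∞ := ENNReal.prod_ne_top fun i _ => hc i
  have hbox : (∏ i, c i)⁻¹ • (Measure.pi μ).toOuterMeasure ≤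
      OuterMeasure.pi fun i => (ν i).toOuterMeasure := by
    refine OuterMeasure.le_pi.2 fun s _ => ?_
    change (∏ i, c i)⁻¹ * Measure.pi μ _ ≤ _
    rw [Measure.pi_pi, ENNReal.inv_mul_le_iff hprod₀ hprod, ← Finset.prod_mul_distrib]
    exact Finset.prod_le_prod' fun i _ => h i (s i)
  refine Measure.le_iff.2 fun S hS => ?_
  rw [Measure.smul_apply, smul_eq_mul, ← ENNReal.inv_mul_le_iff hprod₀ hprod, Measure.pi_def ν,
    toMeasure_apply _ _ hS]
  exact hbox S

lemma map_prod_two_stage_apply {A B V W : Type*} [MeasurableSpace A] [MeasurableSpace B]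
    [MeasurableSpace V] [MeasurableSpace W] {μ : Measure A} {ν : Measure B} [SFinite μ] [SFinite ν]
    {L : A → W} (hL : Measurable L) {H : W → B → V} (hH : Measurable (uncurry H)) {S : Set (W × V)}
    (hS : MeasurableSet S) :
    (μ.prod ν).map (fun p => (L p.1, H (L p.1) p.2)) S =
      ∫⁻ w, ν.map (H w) (Prod.mk w ⁻¹' S) ∂μ.map L := by
  have hpair : Measurable fun p : W × B => (p.1, uncurry H p) := measurable_fst.prodMk hH
  calc (μ.prod ν).map (fun p => (L p.1, H (L p.1) p.2)) S
      = ((μ.map L).prod ν).map (fun p => (p.1, uncurry H p)) S := by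
        rw [show ν = ν.map id from Measure.map_id.symm, Measure.map_prod_map _ _ hL measurable_id,
          Measure.map_id, Measure.map_map hpair (hL.prodMap measurable_id)]
        rfl
    _ = ∫⁻ w, ν (Prod.mk w ⁻¹' ((fun p : W × B => (p.1, uncurry H p)) ⁻¹' S)) ∂μ.map L := by
        rw [Measure.map_apply hpair hS, Measure.prod_apply (hpair hS)]
    _ = ∫⁻ w, ν.map (H w) (Prod.mk w ⁻¹' S) ∂μ.map L :=
        lintegral_congr fun w =>
          (Measure.map_apply hH.of_uncurry_left (measurable_prodMk_left hS)).symm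

end Product

/-! ### The privacy budget -/

section Budget

variable {n : ℕ} {q ε lam : ℝ}

lemma shearFactor_pos (hlam : 0 < lam) (n : ℕ) (q : ℝ) : 0 < shearFactor n q lam := by
  unfold shearFactor
  positivity

lemma shearFactor_eq (n : ℕ) (q lam : ℝ) : shearFactor n q lam =
    1 + q ^ 2 / (2 * n * lam) + q ^ 4 / (16 * (n : ℝ) ^ 2 * lam ^ 2) := by
  unfold shearFactor
  ring

lemma shearFactor_calibrated (hn : n ≠ 0) (hq : q ≠ 0) (t : ℝ) :
    shearFactor n q (q ^ 2 / (4 * n * (Real.exp t - 1))) = Real.exp (2 * t) := by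
  have hn' : (4 * n : ℝ) ≠ 0 := by positivity
  rw [shearFactor, ← mul_div_assoc, mul_div_mul_left _ _ hn', div_div_cancel₀ (pow_ne_zero 2 hq),
    add_sub_cancel, ← Real.exp_nat_mul, Nat.cast_ofNat]

lemma plrEps_pos (hε : 0 < ε) (n : ℕ) (lam : ℝ) : 0 < plrEps n ε lam := by
  unfold plrEps
  split_ifs with hprime
  exacts [hprime, half_pos hε]

lemma lam_add_plrDelta_pos (hn : n ≠ 0) (hε : 0 < ε) (hlam : 0 < lam) :
    0 < lam + plrDelta n ε lam := by
  have hexp : 0 < Real.exp (ε / 4) - 1 := sub_pos.2 (Real.one_lt_exp_iff.2 (by positivity))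
  unfold plrDelta
  split_ifs
  · rwa [add_zero]
  · rw [add_sub_cancel]
    positivity

lemma shearFactor_mul_exp_plrEps (hn : n ≠ 0) (hlam : 0 < lam) (ε : ℝ) :
    shearFactor n 1 (lam + plrDelta n ε lam) * Real.exp (plrEps n ε lam) = Real.exp ε := by
  unfold plrDelta plrEps
  split_ifs
  · have hfactor := shearFactor_eq n 1 lam
    rw [one_pow, one_pow] at hfactor
    rw [add_zero, plrEpsPrime, ← hfactor, Real.exp_sub, Real.exp_log (shearFactor_pos hlam n 1),
      mul_div_cancel₀ _ (shearFactor_pos hlam n 1).ne']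
  · have hcalibrated := shearFactor_calibrated hn one_ne_zero (ε / 4)
    rw [one_pow, one_div] at hcalibrated
    rw [add_sub_cancel, hcalibrated, ← Real.exp_add]
    ring_nf

end Budget

namespace Config

variable {n d K : ℕ} {C : Config n d K} {k : Fin K}

lemma lowEps_pos (hε : 0 < C.ε) : 0 < C.lowEps := by
  unfold lowEps
  split_ifs with hprime
  exacts [hprime, half_pos hε]

lemma lam_add_lowDelta_pos (hε : 0 < C.ε) (hlow : C.low.Nonempty) (hq : 0 ≤ C.q k)
    (hlam : 0 < C.lam k) : 0 < C.lam k + C.lowDelta k := by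
  unfold lowDelta
  split_ifs with hcase
  · rwa [add_zero]
  · have := hlow.card_pos
    have hqpos : 0 < C.q k := hq.lt_of_ne' (not_or.1 hcase).2
    have hexp : 0 < Real.exp (C.ε * C.q k / 4) - 1 :=
      sub_pos.2 (Real.one_lt_exp_iff.2 (by positivity))
    rw [add_sub_cancel]
    positivity

variable (C) in
/-- The factor by which the law of low-level model `k` changes when a sample is replaced. -/
def lowFactor (k : Fin K) : ℝ :=
  shearFactor C.low.card (C.q k) (C.lam k + C.lowDelta k) * Real.exp (C.lowEps * C.q k)

lemma lowFactor_pos (hμ : 0 < C.lam k + C.lowDelta k) : 0 < C.lowFactor k :=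
  mul_pos (shearFactor_pos hμ _ _) (Real.exp_pos _)

lemma lowFactor_of_epsPrime_pos (h : 0 < C.epsPrime) (k : Fin K) :
    C.lowFactor k = shearFactor C.low.card (C.q k) (C.lam k) * Real.exp (C.epsPrime * C.q k) := by
  rw [lowFactor, lowDelta, lowEps, if_pos (Or.inl h), if_pos h, add_zero]

lemma lowFactor_of_epsPrime_nonpos (hlow : C.low.Nonempty) (h : C.epsPrime ≤ 0) (k : Fin K) :
    C.lowFactor k = Real.exp (C.ε * C.q k) := by
  rw [lowFactor, lowEps, if_neg h.not_gt]
  by_cases hq : C.q k = 0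
  · simp [hq, shearFactor]
  · rw [lowDelta, if_neg (not_or.2 ⟨h.not_gt, hq⟩), add_sub_cancel,
      shearFactor_calibrated hlow.card_pos.ne' hq, ← Real.exp_add]
    ring_nf

lemma prod_shearFactor (hlam : ∀ k, 0 < C.lam k) :
    ∏ k, shearFactor C.low.card (C.q k) (C.lam k) = Real.exp (C.ε - C.epsPrime) := by
  simp only [epsPrime, ← shearFactor_eq, sub_sub_cancel, Real.exp_sum,
    Real.exp_log (shearFactor_pos (hlam _) _ _)]

lemma prod_lowFactor_le (hε : 0 ≤ C.ε) (hlow : C.low.Nonempty) (hqsum : ∑ k, C.q k ≤ 1)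
    (hlam : ∀ k, 0 < C.lam k) : ∏ k, C.lowFactor k ≤ Real.exp C.ε := by
  rcases lt_or_ge 0 C.epsPrime with h | h
  · simp only [lowFactor_of_epsPrime_pos h, Finset.prod_mul_distrib, prod_shearFactor hlam]
    rw [← Real.exp_sum, ← Finset.mul_sum, ← Real.exp_add, Real.exp_le_exp]
    linarith [mul_le_of_le_one_right h.le hqsum]
  · simp only [lowFactor_of_epsPrime_nonpos hlow h]
    rw [← Real.exp_sum, ← Finset.mul_sum, Real.exp_le_exp]
    exact mul_le_of_le_one_right hε hqsum

/-! ### Stacking -/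

variable (C) in
/-- The joint law of the low-level models. -/
def lowLaw (D : Fin n → Sample d) : Measure (∀ k, Block C.block k) :=
  (Measure.pi fun k => noise (Block C.block k) C.lowEps).map (C.lowModels D)

variable (C) in
/-- The conditional law of the high-level model given the low-level models `w`. -/
def highLaw (D : Fin n → Sample d) (w : ∀ k, Block C.block k) :
    Measure (EuclideanSpace ℝ (Fin K)) :=
  (noise (EuclideanSpace ℝ (Fin K)) (plrEps C.lowᶜ.card C.ε C.lamHigh)).map
    fun b => argmin (C.highObjective D w b)

lemma lowModels_congr {D D' : Fin n → Sample d} (h : ∀ i ∈ C.low, D i = D' i) :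
    C.lowModels D = C.lowModels D' := by
  funext b k
  exact congrArg argmin (objective_congr (fun i hi => by rw [h i hi])
    (fun i hi => by rw [h i hi]) _ _ _ _)

lemma highObjective_congr {D D' : Fin n → Sample d} (h : ∀ i ∈ C.lowᶜ, D i = D' i) :
    C.highObjective D = C.highObjective D' := by
  funext w b
  exact objective_congr (fun i hi => by simp only [h i hi]) (fun i hi => by rw [h i hi]) _ _ _ _

lemma measurable_argmin_lowObjective (hlam : 0 ≤ C.lam k) (hμ : 0 < C.lam k + C.lowDelta k)
    (hg : StrongConvexOn univ 1 (C.g k)) (D : Fin n → Sample d) :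
    Measurable fun b => argmin (C.lowObjective D k b) :=
  ((continuous_argmin_objective C.low (fun i => (D i).y) hlam hμ hg).comp
    (Continuous.prodMk_right fun i => C.scale k (restrict C.block k (D i).x))).measurable

lemma measurable_lowModels (hlam : ∀ k, 0 ≤ C.lam k) (hμ : ∀ k, 0 < C.lam k + C.lowDelta k)
    (hg : ∀ k, StrongConvexOn univ 1 (C.g k)) (D : Fin n → Sample d) :
    Measurable (C.lowModels D) :=
  measurable_pi_lambda _ fun k =>
    (measurable_argmin_lowObjective (hlam k) (hμ k) (hg k) D).comp (measurable_pi_apply k)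

lemma continuous_metaFeatures (x : EuclideanSpace ℝ (Fin d)) :
    Continuous fun w => C.metaFeatures w x := by
  have := continuous_sigmoid
  unfold metaFeatures
  fun_prop

lemma measurable_argmin_highObjective (hlam : 0 ≤ C.lamHigh)
    (hμ : 0 < C.lamHigh + plrDelta C.lowᶜ.card C.ε C.lamHigh)
    (hg : StrongConvexOn univ 1 C.gHigh) (hs : Measurable C.scaleHigh) (D : Fin n → Sample d) :
    Measurable (uncurry fun w b => argmin (C.highObjective D w b)) := by
  have hargmin := continuous_argmin_objective C.lowᶜ (fun i => (D i).y) hlam hμ hg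
  refine hargmin.measurable.comp
    (f := fun p : (∀ k, Block C.block k) × EuclideanSpace ℝ (Fin K) =>
      ((fun i => C.scaleHigh (C.metaFeatures p.1 (D i).x)), p.2))
    (Measurable.prodMk ?_ measurable_snd)
  exact measurable_pi_lambda _ fun i =>
    hs.comp ((continuous_metaFeatures (D i).x).measurable.comp measurable_fst)

lemma measurable_output {D : Fin n → Sample d} (hL : Measurable (C.lowModels D))
    (hH : Measurable (uncurry fun w b => argmin (C.highObjective D w b))) :
    Measurable (C.output D) := by
  have hlow : Measurable (Prod.map (C.lowModels D) (id : EuclideanSpace ℝ (Fin K) → _)) :=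
    hL.prodMap measurable_id
  have hhigh : Measurable fun p : (∀ k, Block C.block k) × EuclideanSpace ℝ (Fin K) =>
      (p.1, argmin (C.highObjective D p.1 p.2)) := measurable_fst.prodMk hH
  exact hhigh.comp hlow

lemma isProbabilityMeasure_noiseLaw (hε : 0 < C.ε) : IsProbabilityMeasure C.noiseLaw := by
  have hlow := fun k => isProbabilityMeasure_noise (E := Block C.block k) (lowEps_pos hε)
  have hhigh := isProbabilityMeasure_noise (E := EuclideanSpace ℝ (Fin K))
    (plrEps_pos hε C.lowᶜ.card C.lamHigh)
  unfold noiseLaw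
  infer_instance

lemma pstf_apply (hε : 0 < C.ε) {D : Fin n → Sample d} (hL : Measurable (C.lowModels D))
    (hH : Measurable (uncurry fun w b => argmin (C.highObjective D w b)))
    {S : Set ((∀ k, Block C.block k) × EuclideanSpace ℝ (Fin K))} (hS : MeasurableSet S) :
    C.pstf D S = ∫⁻ w, C.highLaw D w (Prod.mk w ⁻¹' S) ∂C.lowLaw D := by
  have hlow := fun k => isProbabilityMeasure_noise (E := Block C.block k) (lowEps_pos hε)
  have hhigh := isProbabilityMeasure_noise (E := EuclideanSpace ℝ (Fin K))
    (plrEps_pos hε C.lowᶜ.card C.lamHigh)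
  exact map_prod_two_stage_apply hL hH hS

lemma lowLaw_le (hε : 0 < C.ε) (hlow : C.low.Nonempty) (hqsum : ∑ k, C.q k ≤ 1)
    (hlam : ∀ k, 0 < C.lam k) (hg : ∀ k, StrongConvexOn univ 1 (C.g k))
    (hscale : ∀ k x, ‖C.scale k x‖ ≤ C.q k) {D D' : Fin n → Sample d} {i : Fin n} (hi : i ∈ C.low)
    (hD : ∀ j, j ≠ i → D j = D' j) :
    C.lowLaw D ≤ ENNReal.ofReal (Real.exp C.ε) • C.lowLaw D' := by
  have hμ : ∀ k, 0 < C.lam k + C.lowDelta k := fun k =>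
    lam_add_lowDelta_pos hε hlow ((norm_nonneg _).trans (hscale k 0)) (hlam k)
  have hm := fun k => measurable_argmin_lowObjective (hlam k).le (hμ k) (hg k)
  have hnoise := fun k => isProbabilityMeasure_noise (E := Block C.block k) (lowEps_pos hε)
  have := fun D k => Measure.isProbabilityMeasure_map
    (μ := noise (Block C.block k) C.lowEps) (hm k D).aemeasurable
  have hlaw : ∀ D, C.lowLaw D = Measure.pi fun k =>
      (noise (Block C.block k) C.lowEps).map fun b => argmin (C.lowObjective D k b) :=
    fun D => Measure.pi_map_pi fun k => (hm k D).aemeasurable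
  have hle := pi_le_smul_pi
    (fun k => (ENNReal.ofReal_pos.2 (lowFactor_pos (hμ k))).ne') (fun k => ENNReal.ofReal_ne_top)
    fun k => map_noise_argmin_objective_le hi
      (x := fun j => C.scale k (restrict C.block k (D j).x))
      (x' := fun j => C.scale k (restrict C.block k (D' j).x))
      (y := fun j => (D j).y) (y' := fun j => (D' j).y)
      (fun j hj => by rw [hD j hj]) (fun j hj => by rw [hD j hj]) (hscale k _) (hscale k _)
      (D i).abs_y_le_one (D' i).abs_y_le_one (lowEps_pos hε).le (hlam k).le (hμ k) (hg k)
  rw [← ENNReal.ofReal_prod_of_nonneg fun k _ => (lowFactor_pos (hμ k)).le] at hle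
  rw [hlaw D, hlaw D']
  have hprod := ENNReal.ofReal_le_ofReal (prod_lowFactor_le hε.le hlow hqsum hlam)
  exact hle.trans (Measure.le_iff.2 fun S _ => mul_le_mul_left hprod _)

lemma highLaw_le (hε : 0 < C.ε) (hhigh : C.lowᶜ.Nonempty) (hlam : 0 < C.lamHigh)
    (hg : StrongConvexOn univ 1 C.gHigh) (hscale : ∀ x, ‖C.scaleHigh x‖ ≤ 1)
    {D D' : Fin n → Sample d} {i : Fin n} (hi : i ∈ C.lowᶜ) (hD : ∀ j, j ≠ i → D j = D' j)
    (w : ∀ k, Block C.block k) :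
    C.highLaw D w ≤ ENNReal.ofReal (Real.exp C.ε) • C.highLaw D' w := by
  have hle := map_noise_argmin_objective_le hi
    (x := fun j => C.scaleHigh (C.metaFeatures w (D j).x))
    (x' := fun j => C.scaleHigh (C.metaFeatures w (D' j).x))
    (y := fun j => (D j).y) (y' := fun j => (D' j).y)
    (fun j hj => by rw [hD j hj]) (fun j hj => by rw [hD j hj]) (hscale _) (hscale _)
    (D i).abs_y_le_one (D' i).abs_y_le_one (plrEps_pos hε C.lowᶜ.card C.lamHigh).le hlam.le
    (lam_add_plrDelta_pos hhigh.card_pos.ne' hε hlam) hg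
  rwa [mul_one, shearFactor_mul_exp_plrEps hhigh.card_pos.ne' hlam] at hle

lemma isDifferentiallyPrivate_pstf (hε : 0 < C.ε) (hL : ∀ D, Measurable (C.lowModels D))
    (hH : ∀ D, Measurable (uncurry fun w b => argmin (C.highObjective D w b)))
    (hlow : ∀ {D D' : Fin n → Sample d} {i}, i ∈ C.low → (∀ j, j ≠ i → D j = D' j) →
      C.lowLaw D ≤ ENNReal.ofReal (Real.exp C.ε) • C.lowLaw D')
    (hhigh : ∀ {D D' : Fin n → Sample d} {i}, i ∈ C.lowᶜ → (∀ j, j ≠ i → D j = D' j) →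
      ∀ w, C.highLaw D w ≤ ENNReal.ofReal (Real.exp C.ε) • C.highLaw D' w) :
    IsDifferentiallyPrivate C.ε C.pstf := by
  rintro D D' ⟨i, hD⟩ S hS
  rw [pstf_apply hε (hL D) (hH D) hS, pstf_apply hε (hL D') (hH D') hS]
  by_cases hi : i ∈ C.low
  · have hsame : C.highLaw D = C.highLaw D' := by
      unfold highLaw
      rw [highObjective_congr fun j hj => hD j fun h => Finset.mem_compl.1 hj (h ▸ hi)]
    rw [hsame, ← smul_eq_mul, ← lintegral_smul_measure]
    exact lintegral_mono' (hlow hi hD) le_rfl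
  · have hsame : C.lowLaw D = C.lowLaw D' := by
      rw [lowLaw, lowLaw, lowModels_congr fun j hj => hD j fun h => hi (h ▸ hj)]
    rw [hsame, ← lintegral_const_mul' _ _ ENNReal.ofReal_ne_top]
    exact lintegral_mono fun w => hhigh (Finset.mem_compl.2 hi) hD w _

end Config

end PrivateStacking

end

open MeasureTheory PrivateStacking in
theorem mainTheorem1_general {n d K : ℕ} (C : Config n d K)
    (hε : 0 < C.ε)
    (hlow : C.low.Nonempty) (hhigh : C.lowᶜ.Nonempty)
    (hqsum : ∑ k, C.q k ≤ 1)
    (hlam : ∀ k, 0 < C.lam k) (hlamHigh : 0 < C.lamHigh)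
    (hg : ∀ k, StrongConvexOn Set.univ 1 (C.g k))
    (hgHigh : StrongConvexOn Set.univ 1 C.gHigh)
    (hscale : ∀ k x, ‖C.scale k x‖ ≤ C.q k)
    (hscaleHigh : ∀ x, ‖C.scaleHigh x‖ ≤ 1) (hscaleHigh_meas : Measurable C.scaleHigh) :
    (∀ D k b, ∃! w, IsMinimizer (C.lowObjective D k b) w) ∧
    (∀ D w b, ∃! v, IsMinimizer (C.highObjective D w b) v) ∧
    (∀ D, IsProbabilityMeasure (C.pstf D)) ∧
    IsDifferentiallyPrivate C.ε C.pstf := by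
  have hμ : ∀ k, 0 < C.lam k + C.lowDelta k := fun k =>
    Config.lam_add_lowDelta_pos hε hlow ((norm_nonneg _).trans (hscale k 0)) (hlam k)
  have hμHigh := lam_add_plrDelta_pos hhigh.card_pos.ne' hε hlamHigh
  have hL := Config.measurable_lowModels (fun k => (hlam k).le) hμ hg
  have hH := Config.measurable_argmin_highObjective hlamHigh.le hμHigh hgHigh hscaleHigh_meas
  refine ⟨fun D k b => ?_, fun D w b => ?_, fun D => ?_, ?_⟩
  · exact existsUnique_isMinimizer (strongConvexOn_objective (hlam k).le (hg k) _ _ _ _ _) (hμ k)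
  · exact existsUnique_isMinimizer (strongConvexOn_objective hlamHigh.le hgHigh _ _ _ _ _) hμHigh
  · have := Config.isProbabilityMeasure_noiseLaw hε
    exact Measure.isProbabilityMeasure_map (Config.measurable_output (hL D) (hH D)).aemeasurable
  · exact Config.isDifferentiallyPrivate_pstf hε hL hH
      (Config.lowLaw_le hε hlow hqsum hlam hg hscale)
      (Config.highLaw_le hε hhigh hlamHigh hgHigh hscaleHigh)

open MeasureTheory PrivateStacking in
theorem mainTheorem1 {n d K : ℕ} (C : Config n d K)
    (hε : 0 < C.ε)
    (hlow : C.low.Nonempty) (hhigh : C.lowᶜ.Nonempty)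
    (hq : ∀ k, 0 ≤ C.q k) (hqsum : ∑ k, C.q k = 1)
    (hlam : ∀ k, 0 < C.lam k) (hlamHigh : 0 < C.lamHigh)
    (hg : ∀ k, StrongConvexOn Set.univ 1 (C.g k))
    (hgHigh : StrongConvexOn Set.univ 1 C.gHigh)
    (hscale : ∀ k, IsScaling (C.q k) (C.scale k))
    (hscaleHigh : IsScaling 1 C.scaleHigh) (hscaleHigh_meas : Measurable C.scaleHigh) :
    -- the algorithm is well defined: all minimization problems are uniquely solvable
    (∀ D k b, ∃! w, IsMinimizer (C.lowObjective D k b) w) ∧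
    (∀ D w b, ∃! v, IsMinimizer (C.highObjective D w b) v) ∧
    -- its output has a law
    (∀ D, IsProbabilityMeasure (C.pstf D)) ∧
    -- and it is differentially private
    IsDifferentiallyPrivate C.ε C.pstf := by
  exact mainTheorem1_general C hε hlow hhigh hqsum.le hlam hlamHigh hg hgHigh
    (fun k x => (hscale k x).2) (fun x => (hscaleHigh x).2) hscaleHigh_meas
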